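/- For complex numbers $a_1,\dots,a_n$ ($n\ge 1$) put $$M_n(a_1,\dots,a_n)=\begin{pmatrix}a_n&-1\\1&0\end{pmatrix}\begin{pmatrix}a_{n-1}&-1\\1&0\end{pmatrix}\cdots\begin{pmatrix}a_1&-1\\1&0\end{pmatrix}.$$ Let $R\subseteq\mathbb{C}$ be closed under addition. A *$\lambda$-quiddity over $R$* of size $n\ge 1$ is a tuple $(a_1,\dots,a_n)\in R^n$ with $M_n(a_1,\dots,a_n)=\pm\mathrm{Id}$. For tuples of size $n,m\ge 2$ put $$(a_1,\dots,a_n)\oplus(b_1,\dots,b_m)=(a_1+b_m,a_2,\dots,a_{n-1},a_n+b_1,b_2,\dots,b_{m-1}),$$ a tuple of size $n+m-2$, and write $(a_1,\dots,a_n)\sim(b_1,\dots,b_n)$ if $(b_1,\dots,b_n)$ is a circular permutation of $(a_1,\dots,a_n)$ or of $(a_n,\dots,a_1)$. A $\lambda$-quiddity $c$ over $R$ of size at least $3$ is *reducible* over $R$ if $c\sim a\oplus b$ for some tuple $a$ of elements of $R$ of size at least $3$ and some $\lambda$-quiddity $b$ over $R$ of size at least $3$; it is *irreducible* over $R$ if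 it is not reducible. (Irreducible $\lambda$-quiddities thus have size at least $3$; in particular $(0,0)$ is not regarded as irreducible.) For $w\in\mathbb{C}$ let $\langle w\rangle=\mathbb{Z}w$. **Theorem.** Let $k\in\mathbb{N}=\{0,1,2,\dots\}$. The set of irreducible $\lambda$-quiddities over $\langle\sqrt{k}\rangle$ is 1. $\{(0,0,0,0)\}$ if $k=0$; 2. $\{(1,1,1),\,(-1,-1,-1)\}\cup\{(0,a,0,-a),\,(a,0,-a,0) : a\in\mathbb{Z}\setminus\{1,-1\}\}$ if $k=1$; 3. $\{(\sqrt2,\sqrt2,\sqrt2,\sqrt2),\,(-\sqrt2,-\sqrt2,-\sqrt2,-\sqrt2)\}\cup\{(0,a\sqrt2,0,-a\sqrt2),\,(a\sqrt2,0,-a\sqrt2,0) : a\in\mathbb{Z}\}$ if $k=2$; 4. $\{(\sqrt3,\sqrt3,\sqrt3,\sqrt3,\sqrt3,\sqrt3),\,(-\sqrt3,-\sqrt3,-\sqrt3,-\sqrt3,-\sqrt3,-\sqrt3)\}\cup\{(0,a\sqrt3,0,-a\sqrt3),\,(a\sqrt3,0,-a\sqrt3,0) : a\in\mathbb{Z}\}$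 if $k=3$; 5. $\{(0,a\sqrt k,0,-a\sqrt k),\,(a\sqrt k,0,-a\sqrt k,0) : a\in\mathbb{Z}\}$ if $k\ge 4$. -/

import Mathlib

namespace Quiddity

/-- The matrix `(a, -1; 1, 0)`. -/
def stepMatrix (a : ℂ) : Matrix (Fin 2) (Fin 2) ℂ :=
  !![a, -1; 1, 0]

/-- `M_n(a₁, …, aₙ)`, the product of the step matrices in the order `aₙ, …, a₁`. -/
def quiddityMatrix (a : List ℂ) : Matrix (Fin 2) (Fin 2) ℂ :=
  (a.reverse.map stepMatrix).prod

/-- A `λ`-quiddity over `R`: a tuple of positive size with entries in `R` and matrix `± Id`. -/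
def IsQuiddity (R : AddSubsemigroup ℂ) (c : List ℂ) : Prop :=
  c ≠ [] ∧ (∀ x ∈ c, x ∈ R) ∧ (quiddityMatrix c = 1 ∨ quiddityMatrix c = -1)

/-- The sum
`(a₁, …, aₙ) ⊕ (b₁, …, bₘ) = (a₁ + bₘ, a₂, …, aₙ₋₁, aₙ + b₁, b₂, …, bₘ₋₁)`.
It is only used for tuples of size at least `3`. -/
def oplus (a b : List ℂ) : List ℂ :=
  (a.headD 0 + b.getLastD 0) :: a.tail.dropLast ++ (a.getLastD 0 + b.headD 0) :: b.tail.dropLast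

/-- `b` is a circular permutation of `a` or of the reversal of `a`. -/
def Equivalent (a b : List ℂ) : Prop :=
  a.IsRotated b ∨ a.reverse.IsRotated b

/-- A `λ`-quiddity `c` over `R` of size at least `3` is reducible if it is equivalent to `a ⊕ b`
where `a` is a tuple over `R`, `b` is a `λ`-quiddity over `R` and both have size at least `3`. -/
def IsReducible (R : AddSubsemigroup ℂ) (c : List ℂ) : Prop :=
  IsQuiddity R c ∧ 3 ≤ c.length ∧
    ∃ a b : List ℂ, (∀ x ∈ a, x ∈ R) ∧ IsQuiddity R b ∧ 3 ≤ a.length ∧ 3 ≤ b.length ∧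
      Equivalent c (oplus a b)

/-- Irreducible `λ`-quiddities have size at least `3`: by convention `(0, 0)` is not irreducible. -/
def IsIrreducible (R : AddSubsemigroup ℂ) (c : List ℂ) : Prop :=
  IsQuiddity R c ∧ 3 ≤ c.length ∧ ¬ IsReducible R c

/-- The set `ℤ w`, that is, the subgroup of `(ℂ, +)` generated by `w`. -/
def cyclic (w : ℂ) : AddSubsemigroup ℂ :=
  (AddSubgroup.zmultiples w).toAddSubmonoid.toAddSubsemigroup

end Quiddity

/-! Write `c` as `w` times integers, with `w ^ 2 = k`. The two entries in the first column of the
matrix product have ratio `w` times a continued fraction in these integers, so a matrix `± Id`,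
whose lower left entry is zero, forces some partial continued fraction to vanish
(`exists_contFrac_eq_zero`). Each step subtracts `1 / (k * x)`, where `x` is the preceding value;
inductive lower bounds show that vanishing requires an entry `0`, or an entry `± 1` if `k = 1`, two
adjacent equal entries `± w` if `k = 2`, four if `k = 3`. For `k ≥ 4` only `0` remains.

Each such block extends by one entry on either side to an explicit quiddity, and can then be split
off from any longer `c` (`isReducible_of_infix`); matrix equations settle the short tuples that
remain. Conversely, the listed tuples are irreducible because a summand `b` would have to be a short
quiddity. Those of size 3 are constant `± 1`, which do not exist over `ℤ w` when `k ≠ 1`. -/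

namespace Quiddity

/-! ### Multiples of `w` and rotation of quiddities -/

lemma mem_cyclic {w x : ℂ} : x ∈ cyclic w ↔ ∃ n : ℤ, (n : ℂ) * w = x := by
  change x ∈ AddSubgroup.zmultiples w ↔ _
  simp [AddSubgroup.mem_zmultiples_iff]

lemma zero_mem_cyclic (w : ℂ) : (0 : ℂ) ∈ cyclic w := mem_cyclic.2 ⟨0, by simp⟩

lemma self_mem_cyclic (w : ℂ) : w ∈ cyclic w := mem_cyclic.2 ⟨1, by simp⟩

lemma intCast_mul_mem_cyclic (w : ℂ) (n : ℤ) : (n : ℂ) * w ∈ cyclic w := mem_cyclic.2 ⟨n, rfl⟩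

lemma neg_mem_cyclic {w x : ℂ} (hx : x ∈ cyclic w) : -x ∈ cyclic w :=
  (AddSubgroup.zmultiples w).neg_mem hx

lemma sub_mem_cyclic {w x y : ℂ} (hx : x ∈ cyclic w) (hy : y ∈ cyclic w) : x - y ∈ cyclic w :=
  (AddSubgroup.zmultiples w).sub_mem hx hy

lemma one_notMem_cyclic {w : ℂ} {k : ℕ} (hw : w ^ 2 = k) (hk : k ≠ 1) : (1 : ℂ) ∉ cyclic w := by
  intro h
  obtain ⟨n, hn⟩ := mem_cyclic.1 h
  have h1 : ((n ^ 2 * k : ℤ) : ℂ) = ((1 : ℤ) : ℂ) := by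
    push_cast
    rw [← hw, ← mul_pow, hn, one_pow]
  have h2 : n ^ 2 * (k : ℤ) = 1 := by exact_mod_cast h1
  rcases Int.eq_one_or_neg_one_of_mul_eq_one' h2 with h3 | h3 <;> omega

lemma quiddityMatrix_append (l m : List ℂ) :
    quiddityMatrix (l ++ m) = quiddityMatrix m * quiddityMatrix l := by
  simp [quiddityMatrix]

/-- For square matrices a one-sided inverse is two-sided; in the case `-1` this is applied after
negating one factor. -/
lemma IsQuiddity.rotate {R : AddSubsemigroup ℂ} {l m : List ℂ} (h : IsQuiddity R (l ++ m)) :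
    IsQuiddity R (m ++ l) := by
  obtain ⟨h1, h2, h3⟩ := h
  refine ⟨by simpa [and_comm, imp_not_comm] using h1, fun x hx => h2 x (by simpa [or_comm] using hx), ?_⟩
  rw [quiddityMatrix_append] at h3 ⊢
  rcases h3 with h3 | h3
  · exact Or.inl (mul_eq_one_comm.1 h3)
  · right
    have : (-quiddityMatrix m) * quiddityMatrix l = 1 := by rw [neg_mul, h3, neg_neg]
    have := mul_eq_one_comm.1 this
    rw [mul_neg] at this
    rw [← this, neg_neg]

lemma Equivalent.length_eq {a b : List ℂ} (h : Equivalent a b) : a.length = b.length := by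
  rcases h with h | h
  · exact h.perm.length_eq
  · simpa using h.perm.length_eq

lemma Equivalent.mem_iff {a b : List ℂ} (h : Equivalent a b) {x : ℂ} : x ∈ a ↔ x ∈ b := by
  rcases h with h | h
  · exact h.mem_iff
  · simpa using h.mem_iff (a := x)

/-! ### Sums of tuples and splitting off a block -/

lemma exists_eq_cons_concat {l : List ℂ} (h : 2 ≤ l.length) :
    ∃ x t y, l = x :: t ++ [y] := by
  match l, h with
  | x :: l', h =>
    have h' : l' ≠ [] := by rintro rfl; simp at h
    exact ⟨x, l'.dropLast, l'.getLast h', by simp [List.dropLast_append_getLast]⟩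

lemma oplus_cons_concat (x y u v : ℂ) (s t : List ℂ) :
    oplus (x :: s ++ [y]) (u :: t ++ [v]) = (x + v) :: s ++ (y + u) :: t := by
  simp [oplus, List.getLastD_eq_getLast?, List.getLast?_append, List.getLast?_cons]

lemma oplus_length {a b : List ℂ} (ha : 2 ≤ a.length) (hb : 2 ≤ b.length) :
    (oplus a b).length + 2 = a.length + b.length := by
  obtain ⟨x, s, y, rfl⟩ := exists_eq_cons_concat ha
  obtain ⟨u, t, v, rfl⟩ := exists_eq_cons_concat hb
  rw [oplus_cons_concat]
  simp
  omega

/-- A quiddity `c` is reducible if a proper block of consecutive entries of `c` completes to a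
quiddity by one entry on each side. -/
lemma isReducible_of_infix {w u v : ℂ} {c t : List ℂ} (hc : IsQuiddity (cyclic w) c)
    (ht : t <:+: c) (hb : IsQuiddity (cyclic w) (u :: t ++ [v])) (ht0 : t ≠ [])
    (hlen : t.length + 3 ≤ c.length) : IsReducible (cyclic w) c := by
  obtain ⟨p, q, rfl⟩ := ht
  have ht1 := List.length_pos_iff.2 ht0
  simp only [List.length_append] at hlen
  -- Read cyclically, `q ++ p` is the complement of the block. It has at least three entries, so it
  -- can serve as `a` once its end entries are corrected by `v` and `u`.
  obtain ⟨x, s, y, hs⟩ := exists_eq_cons_concat (l := q ++ p) (by simp; omega)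
  have hs1 : 1 ≤ s.length := by
    have := congrArg List.length hs
    simp at this
    omega
  have hmem : ∀ z ∈ q ++ p, z ∈ cyclic w := fun z hz => hc.2.1 z (by simp at hz ⊢; tauto)
  rw [hs] at hmem
  refine ⟨hc, by simp; omega, (x - v) :: s ++ [y - u], u :: t ++ [v], ?_, hb, by simp; omega,
    by simp; omega, Or.inl ?_⟩
  · intro z hz
    simp only [List.mem_append, List.mem_cons, List.not_mem_nil, or_false] at hz
    rcases hz with (rfl | hz) | rfl
    · exact sub_mem_cyclic (hmem x (by simp)) (hb.2.1 v (by simp))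
    · exact hmem z (by simp [hz])
    · exact sub_mem_cyclic (hmem y (by simp)) (hb.2.1 u (by simp))
  · rw [oplus_cons_concat]
    have : (x - v + v) :: s ++ (y - u + u) :: t = q ++ (p ++ t) := by
      rw [← List.append_assoc, hs]
      simp
    rw [this]
    exact List.isRotated_append

lemma isQuiddity_zero_alternating {w x : ℂ} (hx : x ∈ cyclic w) :
    IsQuiddity (cyclic w) [0, x, 0, -x] := by
  refine ⟨by simp, ?_, ?_⟩
  · simp [hx, neg_mem_cyclic hx, zero_mem_cyclic]
  · left
    simp [quiddityMatrix, stepMatrix, Matrix.one_fin_two]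

lemma isQuiddity_alternating_zero {w x : ℂ} (hx : x ∈ cyclic w) :
    IsQuiddity (cyclic w) [x, 0, -x, 0] :=
  (isQuiddity_zero_alternating hx).rotate (l := [0]) (m := [x, 0, -x])

/-- A zero and a neighbour `x` form a block of `(-x, 0, x, 0)` or `(0, x, 0, -x)`. The preceding
neighbour is used only when the zero is the last entry. -/
lemma isReducible_of_zero_mem {w : ℂ} {c : List ℂ} (hc : IsQuiddity (cyclic w) c)
    (h0 : (0 : ℂ) ∈ c) (hlen : 5 ≤ c.length) : IsReducible (cyclic w) c := by
  obtain ⟨p, q, rfl⟩ := List.append_of_mem h0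
  match q with
  | x :: q' =>
    have hx : x ∈ cyclic w := hc.2.1 x (by simp)
    have hb := isQuiddity_alternating_zero (neg_mem_cyclic hx)
    rw [neg_neg] at hb
    exact isReducible_of_infix (t := [0, x]) hc ⟨p, q', by simp⟩ hb (by simp) hlen
  | [] =>
    obtain ⟨r, x, rfl⟩ := (List.eq_nil_or_concat p).resolve_left (by rintro rfl; simp at hlen)
    have hx : x ∈ cyclic w := hc.2.1 x (by simp)
    exact isReducible_of_infix (t := [x, 0]) hc ⟨r, [], by simp⟩
      (isQuiddity_zero_alternating hx) (by simp) hlen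

/-! ### Quiddities of size 3 and 4 -/

lemma quiddityMatrix_three {x y z : ℂ}
    (h : quiddityMatrix [x, y, z] = 1 ∨ quiddityMatrix [x, y, z] = -1) :
    (x = 1 ∧ y = 1 ∧ z = 1) ∨ (x = -1 ∧ y = -1 ∧ z = -1) := by
  simp [quiddityMatrix, stepMatrix, Matrix.one_fin_two] at h
  grind

lemma quiddityMatrix_four {x y z t : ℂ}
    (h : quiddityMatrix [x, y, z, t] = 1 ∨ quiddityMatrix [x, y, z, t] = -1) :
    (x * y = 0 ∧ z = -x ∧ t = -y) ∨ (x * y = 2 ∧ z = x ∧ t = y) := by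
  simp [quiddityMatrix, stepMatrix, Matrix.one_fin_two] at h
  grind

lemma length_ne_three_of_isQuiddity {w : ℂ} {k : ℕ} (hw : w ^ 2 = k) (hk : k ≠ 1) {c : List ℂ}
    (hc : IsQuiddity (cyclic w) c) : c.length ≠ 3 := by
  intro h
  obtain ⟨x, y, z, rfl⟩ := List.length_eq_three.1 h
  have hx : x ∈ cyclic w := hc.2.1 x (by simp)
  apply one_notMem_cyclic hw hk
  rcases quiddityMatrix_three hc.2.2 with h | h
  · exact h.1 ▸ hx
  · simpa [h.1] using neg_mem_cyclic hx

/-! ### Continued fractions and the first column of the product -/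

/-- The value at `l` of the continued fraction `a₁ - 1 / (k (a₂ - 1 / (k (a₃ - ⋯))))`. -/
def contFrac (k : ℚ) : List ℤ → ℚ
  | [] => 0
  | a :: t => a - 1 / (k * contFrac k t)

lemma prod_stepMatrix_ne_zero {w : ℂ} {k : ℕ} (hw : w ^ 2 = k) (hk : k ≠ 0) (l : List ℤ)
    (hl : l ≠ []) (h : ∀ t, t ≠ [] → t <:+ l → contFrac k t ≠ 0) :
    ((l.map fun a : ℤ => stepMatrix (a * w)).prod 1 0 ≠ 0) ∧
      (l.map fun a : ℤ => stepMatrix (a * w)).prod 0 0 =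
        w * (contFrac k l : ℚ) * (l.map fun a : ℤ => stepMatrix (a * w)).prod 1 0 := by
  have hw0 : w ≠ 0 := by
    rintro rfl
    simp at hw
    exact hk (by exact_mod_cast hw.symm)
  induction l with
  | nil => simp at hl
  | cons a t ih =>
    by_cases ht : t = []
    · subst ht
      -- Since `1 / 0 = 0`, the value `0` at `[]` makes the continued fraction of `[a]` equal to
      -- `a`.
      simp [stepMatrix, contFrac, mul_comm]
    · obtain ⟨h1, h2⟩ := ih ht fun s hs hs' => h s hs (hs'.trans (List.suffix_cons a t))
      have h3 : ((contFrac k t : ℚ) : ℂ) ≠ 0 := by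
        exact_mod_cast h t ht (List.suffix_cons a t)
      simp only [List.map_cons, List.prod_cons, stepMatrix, Matrix.mul_apply, Fin.sum_univ_two,
        contFrac] at h1 h2 ⊢
      simp only [Matrix.of_apply, Matrix.cons_val', Matrix.cons_val_zero, Matrix.cons_val_one,
        Matrix.cons_val_fin_one]
      rw [h2]
      constructor
      · simp [h1, h3, hw0]
      · push_cast
        rw [← hw]
        field_simp
        ring

lemma exists_contFrac_eq_zero {w : ℂ} {k : ℕ} (hw : w ^ 2 = k) (hk : k ≠ 0) {l : List ℤ}
    (hc : IsQuiddity (cyclic w) (l.map fun a : ℤ => (a : ℂ) * w)) :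
    ∃ t, t ≠ [] ∧ t <:+ l.reverse ∧ contFrac k t = 0 := by
  by_contra! h
  have h1 := (prod_stepMatrix_ne_zero hw hk l.reverse (by simpa using hc.1) h).1
  apply h1
  have h2 : (l.reverse.map fun a : ℤ => stepMatrix (a * w)).prod =
      quiddityMatrix (l.map fun a : ℤ => (a : ℂ) * w) := by
    simp [quiddityMatrix, ← List.map_reverse, Function.comp_def]
  rw [h2]
  rcases hc.2.2 with h | h <;> simp [h]

lemma exists_eq_map {w : ℂ} {c : List ℂ} (hc : ∀ x ∈ c, x ∈ cyclic w) :
    ∃ l : List ℤ, c = l.map fun a : ℤ => (a : ℂ) * w := by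
  have : c ∈ Set.range (List.map fun a : ℤ => (a : ℂ) * w) := by
    rw [Set.range_list_map]
    exact fun x hx => mem_cyclic.1 (hc x hx)
  obtain ⟨l, rfl⟩ := this
  exact ⟨l, rfl⟩

/-! ### Lower bounds for the continued fractions -/

lemma one_div_mul_le {k u v : ℚ} (hk : 0 < k) (hv : 0 < v) (h : v ≤ u) :
    1 / (k * u) ≤ 1 / (k * v) := by
  gcongr

/-- Changing the sign of all entries changes the sign of the value, so the bounds below need only
follow `e` times the value, with `e` the sign of the leading entry. -/
lemma mul_contFrac_cons {k e : ℚ} (he : e = 1 ∨ e = -1) (a : ℤ) (t : List ℤ) :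
    e * contFrac k (a :: t) = e * a - 1 / (k * (e * contFrac k t)) := by
  rcases he with rfl | rfl
  · simp [contFrac]
  · simp [contFrac]
    ring

lemma abs_contFrac_cons (k : ℚ) (hk : 0 < k) (a : ℤ) (t : List ℤ) :
    |(a : ℚ)| - 1 / (k * |contFrac k t|) ≤ |contFrac k (a :: t)| := by
  have h := abs_sub_abs_le_abs_sub (a : ℚ) (1 / (k * contFrac k t))
  rwa [abs_div, abs_one, abs_mul, abs_of_pos hk] at h

/-- The bound reproduces itself: `1 - 1 / (4 * (1 / 2)) = 1 / 2`. -/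
lemma contFrac_bound_of_four_le {k : ℚ} (hk : 4 ≤ k) (l : List ℤ) (hl : l ≠ [])
    (h0 : (0 : ℤ) ∉ l) : 1 / 2 ≤ |contFrac k l| := by
  induction l with
  | nil => simp at hl
  | cons a t ih =>
    have ha : (1 : ℚ) ≤ |(a : ℚ)| := by
      exact_mod_cast Int.one_le_abs (by rintro rfl; simp at h0)
    rcases eq_or_ne t [] with rfl | ht
    · simp [contFrac]
      linarith
    · have h1 := ih ht (fun h => h0 (by simp [h]))
      have h2 := abs_contFrac_cons k (by linarith) a t
      have h3 := one_div_mul_le (k := k) (by linarith) (by norm_num) h1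
      have h4 : 1 / (k * (1 / 2)) ≤ 1 / (4 * (1 / 2)) := by gcongr
      norm_num at h4 h3 h2
      linarith

lemma contFrac_one_bound (l : List ℤ) (hl : l ≠ []) (h : ∀ a ∈ l, 2 ≤ |a|) :
    1 ≤ |contFrac 1 l| := by
  induction l with
  | nil => simp at hl
  | cons a t ih =>
    have ha : (2 : ℚ) ≤ |(a : ℚ)| := by exact_mod_cast h a (by simp)
    rcases eq_or_ne t [] with rfl | ht
    · simp [contFrac]
      linarith
    · have h1 := ih ht (fun b hb => h b (by simp [hb]))
      have h2 := abs_contFrac_cons 1 (by norm_num) a t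
      have h3 := one_div_mul_le (k := 1) (by norm_num) (by norm_num) h1
      norm_num at h3 h2
      linarith

lemma eq_or_two_le_sign_mul {e : ℤ} (he : e = 1 ∨ e = -1) {b : ℤ} (hb : b ≠ 0) :
    b = e ∨ 2 ≤ e * b ∨ b = -e ∨ 2 ≤ -e * b := by
  rcases he with rfl | rfl <;> omega

/-- A leading run of one `e` gives at least `1 - 1 / (2 * 1) = 1 / 2`; a second `e` could bring this
to `0`, hence the excluded block. A larger leading entry gives at least `2 - 1 / (2 * (1 / 2)) = 1`.
A next entry of opposite sign only helps. -/
lemma contFrac_two_bound (l : List ℤ) (hl : l ≠ []) (h0 : (0 : ℤ) ∉ l)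
    (h : ∀ e : ℤ, e = 1 ∨ e = -1 → ¬ [e, e] <:+: l) :
    ∀ e : ℤ, e = 1 ∨ e = -1 →
      (l.head hl = e → 1 / 2 ≤ e * contFrac 2 l) ∧
      (2 ≤ e * l.head hl → 1 ≤ e * contFrac 2 l) := by
  induction l with
  | nil => simp at hl
  | cons a t ih =>
    intro e he
    have he' : (e : ℚ) = 1 ∨ (e : ℚ) = -1 := by exact_mod_cast he
    have hee : (e : ℚ) * e = 1 := by rcases he' with h | h <;> rw [h] <;> norm_num
    rw [List.head_cons]
    have cast2 : 2 ≤ e * a → (2 : ℚ) ≤ e * a := fun h => by exact_mod_cast h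
    rw [mul_contFrac_cons he']
    match t with
    | [] =>
      refine ⟨?_, fun ha => ?_⟩
      · rintro rfl
        simp only [contFrac, mul_zero, div_zero]
        linarith
      · have := cast2 ha
        simp only [contFrac, mul_zero, div_zero]
        linarith
    | b :: s =>
      have ih' := ih (by simp) (fun h => h0 (by simp [h]))
        (fun e he h' => h e he (h'.trans (List.suffix_cons _ _).isInfix))
      obtain ⟨p1, p2⟩ := ih' e he
      obtain ⟨n1, n2⟩ := ih' (-e) (by omega)
      simp only [List.head_cons, Int.cast_neg, neg_mul] at p1 p2 n1 n2
      have hpos : (1 : ℚ) / 2 ≤ e * contFrac 2 (b :: s) →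
          1 / (2 * (e * contFrac 2 (b :: s))) ≤ 1 := fun h => by
        have := one_div_mul_le (k := 2) (by norm_num) (by norm_num) h
        norm_num at this ⊢
        linarith
      have hpos' : (1 : ℚ) ≤ e * contFrac 2 (b :: s) →
          1 / (2 * (e * contFrac 2 (b :: s))) ≤ 1 / 2 := fun h => by
        have := one_div_mul_le (k := 2) (by norm_num) (by norm_num) h
        norm_num at this ⊢
        linarith
      have hneg : (1 : ℚ) / 2 ≤ -(e * contFrac 2 (b :: s)) →
          1 / (2 * (e * contFrac 2 (b :: s))) ≤ 0 := fun h =>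
        div_nonpos_of_nonneg_of_nonpos (by norm_num) (by linarith)
      refine ⟨?_, fun ha => ?_⟩
      · rintro rfl
        rcases eq_or_two_le_sign_mul he (b := b) (by rintro rfl; simp at h0) with hb | hb | hb | hb
        · subst hb
          exact absurd ⟨[], s, by simp⟩ (h b he)
        · have := hpos' (p2 hb)
          linarith
        · have := hneg (n1 hb)
          linarith
        · have := hneg (by linarith [n2 (by linarith)])
          linarith
      · have := cast2 ha
        rcases eq_or_two_le_sign_mul he (b := b) (by rintro rfl; simp at h0) with hb | hb | hb | hb
        · have := hpos (p1 hb)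
          linarith
        · have := hpos' (p2 hb)
          linarith
        · have := hneg (n1 hb)
          linarith
        · have := hneg (by linarith [n2 (by linarith)])
          linarith

/-- Leading runs of one, two and three entries `e` have the bounds `1 - 1 / 3 = 2 / 3`, `1 - 1 / (3
* (2 / 3)) = 1 / 2` and `1 - 1 / (3 * (1 / 2)) = 1 / 3`; a fourth would allow `0`. A larger leading
entry gives at least `2 - 1 / (3 * (1 / 3)) = 1`. -/
lemma contFrac_three_bound (l : List ℤ) (hl : l ≠ []) (h0 : (0 : ℤ) ∉ l)
    (h : ∀ e : ℤ, e = 1 ∨ e = -1 → ¬ [e, e, e, e] <:+: l) :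
    ∀ e : ℤ, e = 1 ∨ e = -1 →
      (l.head hl = e → 1 / 3 ≤ e * contFrac 3 l ∧
        (¬ [e, e, e] <+: l → 1 / 2 ≤ e * contFrac 3 l) ∧
        (¬ [e, e] <+: l → 2 / 3 ≤ e * contFrac 3 l)) ∧
      (2 ≤ e * l.head hl → 1 ≤ e * contFrac 3 l) := by
  induction l with
  | nil => simp at hl
  | cons a t ih =>
    intro e he
    have he' : (e : ℚ) = 1 ∨ (e : ℚ) = -1 := by exact_mod_cast he
    have hee : (e : ℚ) * e = 1 := by rcases he' with h | h <;> rw [h] <;> norm_num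
    rw [List.head_cons]
    have cast2 : 2 ≤ e * a → (2 : ℚ) ≤ e * a := fun h => by exact_mod_cast h
    rw [mul_contFrac_cons he']
    match t with
    | [] =>
      refine ⟨?_, fun ha => ?_⟩
      · rintro rfl
        simp only [contFrac, mul_zero, div_zero]
        exact ⟨by linarith, fun _ => by linarith, fun _ => by linarith⟩
      · have := cast2 ha
        simp only [contFrac, mul_zero, div_zero]
        linarith
    | b :: s =>
      have ih' := ih (by simp) (fun h => h0 (by simp [h]))
        (fun e he h' => h e he (h'.trans (List.suffix_cons _ _).isInfix))
      obtain ⟨p1, p2⟩ := ih' e he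
      obtain ⟨n1, n2⟩ := ih' (-e) (by omega)
      simp only [List.head_cons, Int.cast_neg, neg_mul] at p1 p2 n1 n2
      have hpos : ∀ c : ℚ, 0 < c → c ≤ e * contFrac 3 (b :: s) →
          1 / (3 * (e * contFrac 3 (b :: s))) ≤ 1 / (3 * c) := fun c hc h =>
        one_div_mul_le (k := 3) (by norm_num) hc h
      have hneg : (1 : ℚ) / 3 ≤ -(e * contFrac 3 (b :: s)) →
          1 / (3 * (e * contFrac 3 (b :: s))) ≤ 0 := fun h =>
        div_nonpos_of_nonneg_of_nonpos (by norm_num) (by linarith)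
      refine ⟨?_, fun ha => ?_⟩
      · rintro rfl
        rcases eq_or_two_le_sign_mul he (b := b) (by rintro rfl; simp at h0) with hb | hb | hb | hb
        · subst hb
          obtain ⟨-, q2, q3⟩ := p1 rfl
          refine ⟨?_, fun h3 => ?_, fun h2 => ?_⟩
          · have h4 : ¬ [b, b, b] <+: b :: s := fun h4 =>
              h b he (List.IsPrefix.isInfix (by simpa using h4))
            have := hpos _ (by norm_num) (q2 h4)
            norm_num at this ⊢
            linarith
          · have h4 : ¬ [b, b] <+: b :: s := fun h4 => h3 (by simpa using h4)
            have := hpos _ (by norm_num) (q3 h4)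
            norm_num at this ⊢
            linarith
          · simp at h2
        · have := hpos _ (by norm_num) (p2 hb)
          norm_num at this ⊢
          exact ⟨by linarith, fun _ => by linarith, fun _ => by linarith⟩
        · have := hneg (n1 hb).1
          exact ⟨by linarith, fun _ => by linarith, fun _ => by linarith⟩
        · have := hneg (by linarith [n2 (by linarith)])
          exact ⟨by linarith, fun _ => by linarith, fun _ => by linarith⟩
      · have := cast2 ha
        rcases eq_or_two_le_sign_mul he (b := b) (by rintro rfl; simp at h0) with hb | hb | hb | hb
        · have := hpos _ (by norm_num) (p1 hb).1
          norm_num at this ⊢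
          linarith
        · have := hpos _ (by norm_num) (p2 hb)
          norm_num at this ⊢
          linarith
        · have := hneg (n1 hb).1
          linarith
        · have := hneg (by linarith [n2 (by linarith)])
          linarith

/-! ### Short tuples and tuples containing zero -/

/-- The sizes of `a` and `b` add up to 6, so `b` would have size 3. -/
lemma isIrreducible_of_length_four {w : ℂ} {k : ℕ} (hw : w ^ 2 = k) (hk : k ≠ 1) {c : List ℂ}
    (hc : IsQuiddity (cyclic w) c) (h4 : c.length = 4) : IsIrreducible (cyclic w) c := by
  refine ⟨hc, by omega, ?_⟩
  rintro ⟨-, -, a, b, -, hb, ha3, hb3, h⟩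
  have h1 := h.length_eq
  have h2 := oplus_length (a := a) (b := b) (by omega) (by omega)
  exact length_ne_three_of_isQuiddity hw hk hb (by omega)

lemma isIrreducible_of_length_three {R : AddSubsemigroup ℂ} {c : List ℂ}
    (hc : IsQuiddity R c) (h3 : c.length = 3) : IsIrreducible R c := by
  refine ⟨hc, by omega, ?_⟩
  rintro ⟨-, -, a, b, -, hb, ha3, hb3, h⟩
  have h1 := h.length_eq
  have h2 := oplus_length (a := a) (b := b) (by omega) (by omega)
  omega

lemma exists_eq_of_zero_mem {w : ℂ} {c : List ℂ} (hc : IsIrreducible (cyclic w) c)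
    (h0 : (0 : ℂ) ∈ c) :
    ∃ a : ℤ, c = [0, a * w, 0, -(a * w)] ∨ c = [a * w, 0, -(a * w), 0] := by
  obtain ⟨hq, h3, hr⟩ := hc
  have h5 : c.length < 5 := by
    by_contra! h
    exact hr (isReducible_of_zero_mem hq h0 h)
  match c, h3, h5 with
  | [x, y, z], _, _ =>
    exfalso
    rcases quiddityMatrix_three hq.2.2 with ⟨rfl, rfl, rfl⟩ | ⟨rfl, rfl, rfl⟩ <;> simp at h0
  | [x, y, z, t], _, _ =>
    obtain ⟨a, rfl⟩ := mem_cyclic.1 (hq.2.1 x (by simp))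
    obtain ⟨b, rfl⟩ := mem_cyclic.1 (hq.2.1 y (by simp))
    rcases quiddityMatrix_four hq.2.2 with ⟨h, rfl, rfl⟩ | ⟨h, rfl, rfl⟩
    · rcases mul_eq_zero.1 h with h | h
      · exact ⟨b, Or.inl (by simp [h])⟩
      · exact ⟨a, Or.inr (by simp [h])⟩
    · exfalso
      simp only [List.mem_cons, List.not_mem_nil, or_false] at h0
      rcases h0 with h0 | h0 | h0 | h0 <;> simp [← h0] at h

/-! ### Blocks forced by a vanishing continued fraction -/

lemma zero_mem_map {w : ℂ} {l : List ℤ} (h : (0 : ℤ) ∈ l) :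
    (0 : ℂ) ∈ l.map fun a : ℤ => (a : ℂ) * w :=
  List.mem_map.2 ⟨0, h, by simp⟩

lemma replicate_infix_map {w : ℂ} {l t : List ℤ} (ht : t <:+ l.reverse) {n : ℕ} {e : ℤ}
    (h : List.replicate n e <:+: t) :
    List.replicate n ((e : ℂ) * w) <:+: l.map fun a : ℤ => (a : ℂ) * w := by
  have h1 := (h.trans ht.isInfix).map (fun a : ℤ => (a : ℂ) * w)
  rw [List.map_replicate, List.map_reverse, ← List.reverse_infix, List.reverse_reverse,
    List.reverse_replicate] at h1
  exact h1

lemma zero_mem_of_four_le {w : ℂ} {k : ℕ} (hw : w ^ 2 = k) (hk : 4 ≤ k) {c : List ℂ}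
    (hc : IsQuiddity (cyclic w) c) : (0 : ℂ) ∈ c := by
  obtain ⟨l, rfl⟩ := exists_eq_map hc.2.1
  obtain ⟨t, ht0, ht, h⟩ := exists_contFrac_eq_zero hw (by omega) hc
  by_contra h0
  have := contFrac_bound_of_four_le (k := k) (by exact_mod_cast hk) t ht0
    fun h => h0 (zero_mem_map (by simpa using ht.subset h))
  rw [h] at this
  norm_num at this

lemma zero_or_unit_mem_of_sq_eq_one {w : ℂ} (hw : w ^ 2 = 1) {c : List ℂ} (hc : IsQuiddity (cyclic w) c) :
    (0 : ℂ) ∈ c ∨ w ∈ c ∨ -w ∈ c := by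
  obtain ⟨l, rfl⟩ := exists_eq_map hc.2.1
  obtain ⟨t, ht0, ht, h⟩ := exists_contFrac_eq_zero (k := 1) (by simpa using hw) (by omega) hc
  by_contra! h0
  have := contFrac_one_bound t ht0 fun a ha => by
    have ha' : a ∈ l := by simpa using ht.subset ha
    by_contra! h2
    have h3 := abs_lt.1 h2
    obtain rfl | rfl | rfl : a = 0 ∨ a = 1 ∨ a = -1 := by omega
    · exact h0.1 (zero_mem_map ha')
    · exact h0.2.1 (List.mem_map.2 ⟨1, ha', by simp⟩)
    · exact h0.2.2 (List.mem_map.2 ⟨-1, ha', by simp⟩)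
  rw [Nat.cast_one] at h
  rw [h] at this
  norm_num at this

lemma exists_sign_eq_or_two_le (a : ℤ) (ha : a ≠ 0) :
    ∃ e : ℤ, (e = 1 ∨ e = -1) ∧ (a = e ∨ 2 ≤ e * a) := by
  rcases lt_or_gt_of_ne ha with h | h
  · exact ⟨-1, by simp, by omega⟩
  · exact ⟨1, by simp, by omega⟩

lemma replicate_two_infix_of_sq_eq_two {w : ℂ} (hw : w ^ 2 = 2) {c : List ℂ} (hc : IsQuiddity (cyclic w) c) :
    (0 : ℂ) ∈ c ∨ ∃ v : ℂ, (v = w ∨ v = -w) ∧ List.replicate 2 v <:+: c := by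
  obtain ⟨l, rfl⟩ := exists_eq_map hc.2.1
  obtain ⟨t, ht0, ht, h⟩ := exists_contFrac_eq_zero (k := 2) (by simpa using hw) (by omega) hc
  by_contra! h0
  obtain ⟨h0, h1⟩ := h0
  have h0' : (0 : ℤ) ∉ t := fun h => h0 (zero_mem_map (by simpa using ht.subset h))
  obtain ⟨e, he, hh⟩ := exists_sign_eq_or_two_le (t.head ht0) fun h => h0' (h ▸ List.head_mem ht0)
  have := contFrac_two_bound t ht0 h0' (fun e he h =>
    h1 (e * w) (by rcases he with rfl | rfl <;> simp) (replicate_infix_map ht h)) e he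
  rw [Nat.cast_ofNat] at h
  rw [h, mul_zero] at this
  rcases hh with hh | hh
  · have := this.1 hh
    norm_num at this
  · have := this.2 hh
    norm_num at this

lemma replicate_four_infix_of_sq_eq_three {w : ℂ} (hw : w ^ 2 = 3) {c : List ℂ} (hc : IsQuiddity (cyclic w) c) :
    (0 : ℂ) ∈ c ∨ ∃ v : ℂ, (v = w ∨ v = -w) ∧ List.replicate 4 v <:+: c := by
  obtain ⟨l, rfl⟩ := exists_eq_map hc.2.1
  obtain ⟨t, ht0, ht, h⟩ := exists_contFrac_eq_zero (k := 3) (by simpa using hw) (by omega) hc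
  by_contra! h0
  obtain ⟨h0, h1⟩ := h0
  have h0' : (0 : ℤ) ∉ t := fun h => h0 (zero_mem_map (by simpa using ht.subset h))
  obtain ⟨e, he, hh⟩ := exists_sign_eq_or_two_le (t.head ht0) fun h => h0' (h ▸ List.head_mem ht0)
  have := contFrac_three_bound t ht0 h0' (fun e he h =>
    h1 (e * w) (by rcases he with rfl | rfl <;> simp) (replicate_infix_map ht h)) e he
  rw [Nat.cast_ofNat] at h
  rw [h, mul_zero] at this
  rcases hh with hh | hh
  · have := (this.1 hh).1
    norm_num at this
  · have := this.2 hh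
    norm_num at this

/-! ### Explicit quiddities and completion of the forced blocks -/

lemma isQuiddity_replicate_three {w v : ℂ} (hv : v ∈ cyclic w) (h : v = 1 ∨ v = -1) :
    IsQuiddity (cyclic w) [v, v, v] := by
  refine ⟨by simp, by simpa using hv, ?_⟩
  rcases h with rfl | rfl
  · right
    ext i j
    fin_cases i <;> fin_cases j <;> simp [quiddityMatrix, stepMatrix]
  · left
    ext i j
    fin_cases i <;> fin_cases j <;> simp [quiddityMatrix, stepMatrix]

lemma isQuiddity_replicate_four {w v : ℂ} (hv : v ∈ cyclic w) (h : v ^ 2 = 2) :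
    IsQuiddity (cyclic w) [v, v, v, v] := by
  refine ⟨by simp, by simpa using hv, Or.inr ?_⟩
  ext i j
  fin_cases i <;> fin_cases j <;> simp [quiddityMatrix, stepMatrix] <;> grind

lemma isQuiddity_replicate_six {w v : ℂ} (hv : v ∈ cyclic w) (h : v ^ 2 = 3) :
    IsQuiddity (cyclic w) [v, v, v, v, v, v] := by
  refine ⟨by simp, by simpa using hv, Or.inr ?_⟩
  ext i j
  fin_cases i <;> fin_cases j <;> simp [quiddityMatrix, stepMatrix] <;> grind

lemma quiddityMatrix_five {v x : ℂ} (hv : v ^ 2 = 3)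
    (h : quiddityMatrix [v, v, v, v, x] = 1 ∨ quiddityMatrix [v, v, v, v, x] = -1) : False := by
  simp [quiddityMatrix, stepMatrix, Matrix.one_fin_two] at h
  grind

lemma quiddityMatrix_six {v x y : ℂ} (hv : v ^ 2 = 3)
    (h : quiddityMatrix [v, v, v, v, x, y] = 1 ∨ quiddityMatrix [v, v, v, v, x, y] = -1) :
    x = v ∧ y = v := by
  simp [quiddityMatrix, stepMatrix, Matrix.one_fin_two] at h
  grind

/-- After rotation, the product of the steps for `y` and `x` is `±` the inverse of the matrix of
`(v, v, v)`. Comparing lower right entries gives `-1 = ± v`, against `v ^ 2 = 3`. -/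
lemma quiddityMatrix_three_block {v x y : ℂ} (hv : v ^ 2 = 3)
    (h : quiddityMatrix [x, v, v, v, y] = 1 ∨ quiddityMatrix [x, v, v, v, y] = -1) : False := by
  have h' : quiddityMatrix ([v, v, v] ++ [y, x]) = 1 ∨ quiddityMatrix ([v, v, v] ++ [y, x]) = -1 :=
    -- Taking `R = ⊤` makes the membership condition void.
    (IsQuiddity.rotate (R := ⊤) (l := [x]) (m := [v, v, v, y]) ⟨by simp, by simp, h⟩).2.2
  simp [quiddityMatrix, stepMatrix, Matrix.one_fin_two] at h'
  grind

lemma eq_of_one {c : List ℂ} {v : ℂ} (hc : IsIrreducible (cyclic 1) c) (hv : v = 1 ∨ v = -1)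
    (h : v ∈ c) : c = [v, v, v] := by
  obtain ⟨hq, h3, hr⟩ := hc
  have h4 : c.length = 3 := by
    by_contra h4
    obtain ⟨p, q, rfl⟩ := List.append_of_mem h
    exact hr (isReducible_of_infix (t := [v]) hq ⟨p, q, by simp⟩
      (isQuiddity_replicate_three (hq.2.1 v h) hv) (by simp) (by simp at h3 h4 ⊢; omega))
  obtain ⟨x, y, z, rfl⟩ := List.length_eq_three.1 h4
  rcases quiddityMatrix_three hq.2.2 with ⟨rfl, rfl, rfl⟩ | ⟨rfl, rfl, rfl⟩ <;> simp_all

/-- By size, `b` has three entries, all `1` or all `-1`, and its middle entry survives unchanged in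
the sum. -/
lemma not_isReducible_of_one_notMem {c : List ℂ} (h1 : (1 : ℂ) ∉ c) (h2 : (-1 : ℂ) ∉ c)
    (h4 : c.length = 4) (R : AddSubsemigroup ℂ) : ¬ IsReducible R c := by
  rintro ⟨-, -, a, b, -, hb, ha3, hb3, h⟩
  have h5 := h.length_eq
  have h6 := oplus_length (a := a) (b := b) (by omega) (by omega)
  obtain ⟨x, y, z, rfl⟩ := List.length_eq_three.1 (show b.length = 3 by omega)
  have hy : y ∈ c := h.mem_iff.2 (by simp [oplus])
  rcases quiddityMatrix_three hb.2.2 with ⟨-, rfl, -⟩ | ⟨-, rfl, -⟩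
  · exact h1 hy
  · exact h2 hy

lemma eq_replicate_of_sq_eq_two {w : ℂ} (hw : w ^ 2 = 2) {c : List ℂ} {v : ℂ} (hc : IsIrreducible (cyclic w) c)
    (hv : v = w ∨ v = -w) (h : List.replicate 2 v <:+: c) : c = [v, v, v, v] := by
  obtain ⟨hq, h3, hr⟩ := hc
  have hv2 : v ^ 2 = 2 := by rcases hv with rfl | rfl <;> simpa using hw
  have hvm : v ∈ cyclic w := hq.2.1 v (h.subset (by simp))
  have h5 : c.length < 5 := by
    by_contra! h5
    exact hr (isReducible_of_infix hq h (isQuiddity_replicate_four hvm hv2) (by simp) h5)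
  have h3' := length_ne_three_of_isQuiddity (k := 2) (by simpa using hw) (by omega) hq
  obtain ⟨p, q, rfl⟩ := h
  have hq' : IsQuiddity (cyclic w) ([v, v] ++ (q ++ p)) := by
    have := hq.rotate
    rw [← List.append_assoc] at this
    have := this.rotate
    simpa using this
  have hlen : (q ++ p).length = 2 := by simp at h3 h3' h5 ⊢; omega
  obtain ⟨x, y, hxy⟩ := List.length_eq_two.1 hlen
  rw [hxy] at hq'
  have hxy' : x = v ∧ y = v := by
    rcases quiddityMatrix_four hq'.2.2 with h | h
    · exfalso
      rw [← sq, hv2] at h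
      simp at h
    · exact h.2
  have hall : ∀ z ∈ q ++ p, z = v := by simp [hxy, hxy']
  exact List.eq_replicate_iff (n := 4).2 ⟨by simp at hlen ⊢; omega, fun z hz => by
    simp at hz hall; grind⟩

lemma eq_replicate_of_sq_eq_three {w : ℂ} (hw : w ^ 2 = 3) {c : List ℂ} {v : ℂ} (hc : IsIrreducible (cyclic w) c)
    (hv : v = w ∨ v = -w) (h : List.replicate 4 v <:+: c) :
    c = [v, v, v, v, v, v] := by
  obtain ⟨hq, h3, hr⟩ := hc
  have hv2 : v ^ 2 = 3 := by rcases hv with rfl | rfl <;> simpa using hw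
  have hvm : v ∈ cyclic w := hq.2.1 v (h.subset (by simp))
  have h7 : c.length < 7 := by
    by_contra! h7
    exact hr (isReducible_of_infix hq h (isQuiddity_replicate_six hvm hv2) (by simp) h7)
  obtain ⟨p, q, rfl⟩ := h
  have hq' : IsQuiddity (cyclic w) ([v, v, v, v] ++ (q ++ p)) := by
    have := hq.rotate
    rw [← List.append_assoc] at this
    have := this.rotate
    simpa using this
  have hlen : (q ++ p).length < 3 := by simp at h7 ⊢; omega
  match hs : q ++ p, hlen with
  | [], _ =>
    exfalso
    rw [hs] at hq'
    rcases quiddityMatrix_four hq'.2.2 with h | h <;> grind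
  | [x], _ =>
    rw [hs] at hq'
    exact (quiddityMatrix_five hv2 hq'.2.2).elim
  | [x, y], _ =>
    rw [hs] at hq'
    have hxy' := quiddityMatrix_six hv2 hq'.2.2
    have hall : ∀ z ∈ q ++ p, z = v := by simp [hs, hxy']
    have hlen2 : (q ++ p).length = 2 := by simp [hs]
    exact List.eq_replicate_iff (n := 6).2 ⟨by simp at hlen2 ⊢; omega, fun z hz => by
      simp at hz hall; grind⟩

/-- The sizes add up to 8 and `b` cannot have size 3, so `b` has two or three interior entries.
These survive in the sum, hence equal `v`, and neither `(u, v, v, z)` nor `(u, v, v, v, z)` is a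
quiddity. -/
lemma isIrreducible_replicate_six {w v : ℂ} (hw : w ^ 2 = 3) (hv : v = w ∨ v = -w) :
    IsIrreducible (cyclic w) [v, v, v, v, v, v] := by
  have hv2 : v ^ 2 = 3 := by rcases hv with rfl | rfl <;> simpa using hw
  have hvm : v ∈ cyclic w := by
    rcases hv with rfl | rfl
    · exact self_mem_cyclic v
    · exact neg_mem_cyclic (self_mem_cyclic w)
  refine ⟨isQuiddity_replicate_six hvm hv2, by simp, ?_⟩
  rintro ⟨-, -, a, b, -, hb, ha3, hb3, h⟩
  have h1 := h.length_eq
  have h2 := oplus_length (a := a) (b := b) (by omega) (by omega)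
  have hb3' := length_ne_three_of_isQuiddity (k := 3) (by simpa using hw) (by omega) hb
  obtain ⟨x, s, y, rfl⟩ := exists_eq_cons_concat (l := a) (by omega)
  obtain ⟨u, t, z, rfl⟩ := exists_eq_cons_concat (l := b) (by omega)
  rw [oplus_cons_concat] at h
  have ht : ∀ r ∈ t, r = v := fun r hr => by
    simpa using h.mem_iff.2 (show r ∈ _ by simp [hr])
  have htn := List.eq_replicate_of_mem ht
  have hlen : t.length = 2 ∨ t.length = 3 := by
    simp at h1 h2 ha3 hb3 hb3'
    omega
  rw [htn] at hb
  rcases hlen with hl | hl <;> rw [hl] at hb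
  · have hq : IsQuiddity (cyclic w) ([v, v] ++ [z, u]) := hb.rotate (l := [u]) (m := [v, v, z])
    rcases quiddityMatrix_four hq.2.2 with h | h <;> grind
  · exact quiddityMatrix_three_block hv2 hb.2.2

lemma sqrt_sq_cast (k : ℕ) : (((√(k : ℝ) : ℝ) : ℂ)) ^ 2 = k := by
  rw [← Complex.ofReal_pow, Real.sq_sqrt (Nat.cast_nonneg k), Complex.ofReal_natCast]

lemma isIrreducible_alternating {w : ℂ} {k : ℕ} (hw : w ^ 2 = k) (hk : k ≠ 1) {c : List ℂ}
    {a : ℤ} (h : c = [0, a * w, 0, -(a * w)] ∨ c = [a * w, 0, -(a * w), 0]) :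
    IsIrreducible (cyclic w) c := by
  rcases h with rfl | rfl
  · exact isIrreducible_of_length_four hw hk
      (isQuiddity_zero_alternating (intCast_mul_mem_cyclic w a)) rfl
  · exact isIrreducible_of_length_four hw hk
      (isQuiddity_alternating_zero (intCast_mul_mem_cyclic w a)) rfl

/-! ### The classification for each `k` -/

theorem isIrreducible_cyclic_zero_iff {c : List ℂ} :
    IsIrreducible (cyclic 0) c ↔ c = [0, 0, 0, 0] := by
  constructor
  · intro hc
    have h0 : (0 : ℂ) ∈ c := by
      obtain ⟨x, t, rfl⟩ := List.exists_cons_of_ne_nil hc.1.1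
      obtain ⟨n, rfl⟩ := mem_cyclic.1 (hc.1.2.1 x (by simp))
      simp
    obtain ⟨a, ha⟩ := exists_eq_of_zero_mem hc h0
    simpa using ha
  · intro h
    exact isIrreducible_alternating (k := 0) (a := 0) (by simp) (by omega) (by simpa using h)

theorem isIrreducible_cyclic_one_iff {c : List ℂ} :
    IsIrreducible (cyclic 1) c ↔ (c = [1, 1, 1] ∨ c = [-1, -1, -1]) ∨
      ∃ a : ℤ, a ≠ 1 ∧ a ≠ -1 ∧
        (c = [0, (a : ℂ), 0, -(a : ℂ)] ∨ c = [(a : ℂ), 0, -(a : ℂ), 0]) := by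
  constructor
  · intro hc
    by_cases h1 : (1 : ℂ) ∈ c
    · exact Or.inl (Or.inl (eq_of_one hc (Or.inl rfl) h1))
    by_cases h2 : (-1 : ℂ) ∈ c
    · exact Or.inl (Or.inr (eq_of_one hc (Or.inr rfl) h2))
    have h0 : (0 : ℂ) ∈ c := by
      rcases zero_or_unit_mem_of_sq_eq_one (by simp) hc.1 with h | h | h
      exacts [h, absurd h h1, absurd h h2]
    obtain ⟨a, ha⟩ := exists_eq_of_zero_mem hc h0
    simp only [mul_one] at ha
    refine Or.inr ⟨a, ?_, ?_, ha⟩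
    · rintro rfl
      rcases ha with rfl | rfl <;> simp at h1
    · rintro rfl
      rcases ha with rfl | rfl <;> simp at h1
  · rintro ((rfl | rfl) | ⟨a, h1, h2, h⟩)
    · exact isIrreducible_of_length_three
        (isQuiddity_replicate_three (self_mem_cyclic 1) (Or.inl rfl)) rfl
    · exact isIrreducible_of_length_three
        (isQuiddity_replicate_three (neg_mem_cyclic (self_mem_cyclic 1)) (Or.inr rfl)) rfl
    · have ha : (a : ℂ) ∈ cyclic 1 := mem_cyclic.2 ⟨a, by simp⟩
      have hq : IsQuiddity (cyclic 1) c := by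
        rcases h with rfl | rfl
        · exact isQuiddity_zero_alternating ha
        · exact isQuiddity_alternating_zero ha
      have h4 : c.length = 4 := by rcases h with rfl | rfl <;> rfl
      have h1' : (a : ℂ) ≠ 1 := by exact_mod_cast h1
      have h2' : (a : ℂ) ≠ -1 := by exact_mod_cast h2
      refine ⟨hq, by omega, not_isReducible_of_one_notMem ?_ ?_ h4 _⟩ <;>
        rcases h with rfl | rfl <;> simp <;> grind

theorem isIrreducible_cyclic_iff_of_sq_eq_two {w : ℂ} (hw : w ^ 2 = 2) {c : List ℂ} :
    IsIrreducible (cyclic w) c ↔ (c = [w, w, w, w] ∨ c = [-w, -w, -w, -w]) ∨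
      ∃ a : ℤ, c = [0, a * w, 0, -(a * w)] ∨ c = [a * w, 0, -(a * w), 0] := by
  have hw' : w ^ 2 = (2 : ℕ) := by simpa using hw
  constructor
  · intro hc
    rcases replicate_two_infix_of_sq_eq_two hw hc.1 with h0 | ⟨v, hv, h⟩
    · exact Or.inr (exists_eq_of_zero_mem hc h0)
    · have := eq_replicate_of_sq_eq_two hw hc hv h
      rcases hv with rfl | rfl <;> simp [this]
  · rintro ((rfl | rfl) | ⟨a, h⟩)
    · exact isIrreducible_of_length_four hw' (by omega)
        (isQuiddity_replicate_four (self_mem_cyclic w) hw) rfl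
    · exact isIrreducible_of_length_four hw' (by omega)
        (isQuiddity_replicate_four (neg_mem_cyclic (self_mem_cyclic w)) (by simpa using hw)) rfl
    · exact isIrreducible_alternating hw' (by omega) h

theorem isIrreducible_cyclic_iff_of_sq_eq_three {w : ℂ} (hw : w ^ 2 = 3) {c : List ℂ} :
    IsIrreducible (cyclic w) c ↔ (c = [w, w, w, w, w, w] ∨ c = [-w, -w, -w, -w, -w, -w]) ∨
      ∃ a : ℤ, c = [0, a * w, 0, -(a * w)] ∨ c = [a * w, 0, -(a * w), 0] := by
  constructor
  · intro hc
    rcases replicate_four_infix_of_sq_eq_three hw hc.1 with h0 | ⟨v, hv, h⟩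
    · exact Or.inr (exists_eq_of_zero_mem hc h0)
    · have := eq_replicate_of_sq_eq_three hw hc hv h
      rcases hv with rfl | rfl <;> simp [this]
  · rintro ((rfl | rfl) | ⟨a, h⟩)
    · exact isIrreducible_replicate_six hw (Or.inl rfl)
    · exact isIrreducible_replicate_six hw (Or.inr rfl)
    · exact isIrreducible_alternating (k := 3) (by simpa using hw) (by omega) h

theorem isIrreducible_cyclic_iff_of_four_le {w : ℂ} {k : ℕ} (hw : w ^ 2 = k) (hk : 4 ≤ k)
    {c : List ℂ} :
    IsIrreducible (cyclic w) c ↔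
      ∃ a : ℤ, c = [0, a * w, 0, -(a * w)] ∨ c = [a * w, 0, -(a * w), 0] :=
  ⟨fun hc => exists_eq_of_zero_mem hc (zero_mem_of_four_le hw hk hc.1),
    fun ⟨_, h⟩ => isIrreducible_alternating hw (by omega) h⟩

end Quiddity

theorem mainTheorem1 :
    ({c : List ℂ | Quiddity.IsIrreducible (Quiddity.cyclic ((√0 : ℝ) : ℂ)) c} =
      {[0, 0, 0, 0]}) ∧
    ({c : List ℂ | Quiddity.IsIrreducible (Quiddity.cyclic ((√1 : ℝ) : ℂ)) c} =
      {[1, 1, 1], [-1, -1, -1]} ∪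
      {c : List ℂ | ∃ a : ℤ, a ≠ 1 ∧ a ≠ -1 ∧
        (c = [0, (a : ℂ), 0, -(a : ℂ)] ∨ c = [(a : ℂ), 0, -(a : ℂ), 0])}) ∧
    ({c : List ℂ | Quiddity.IsIrreducible (Quiddity.cyclic ((√2 : ℝ) : ℂ)) c} =
      {[((√2 : ℝ) : ℂ), ((√2 : ℝ) : ℂ), ((√2 : ℝ) : ℂ), ((√2 : ℝ) : ℂ)],
       [-((√2 : ℝ) : ℂ), -((√2 : ℝ) : ℂ), -((√2 : ℝ) : ℂ), -((√2 : ℝ) : ℂ)]} ∪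
      {c : List ℂ | ∃ a : ℤ,
        c = [0, a * ((√2 : ℝ) : ℂ), 0, -(a * ((√2 : ℝ) : ℂ))] ∨
        c = [a * ((√2 : ℝ) : ℂ), 0, -(a * ((√2 : ℝ) : ℂ)), 0]}) ∧
    ({c : List ℂ | Quiddity.IsIrreducible (Quiddity.cyclic ((√3 : ℝ) : ℂ)) c} =
      {[((√3 : ℝ) : ℂ), ((√3 : ℝ) : ℂ), ((√3 : ℝ) : ℂ),
        ((√3 : ℝ) : ℂ), ((√3 : ℝ) : ℂ), ((√3 : ℝ) : ℂ)],
       [-((√3 : ℝ) : ℂ), -((√3 : ℝ) : ℂ), -((√3 : ℝ) : ℂ),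
        -((√3 : ℝ) : ℂ), -((√3 : ℝ) : ℂ), -((√3 : ℝ) : ℂ)]} ∪
      {c : List ℂ | ∃ a : ℤ,
        c = [0, a * ((√3 : ℝ) : ℂ), 0, -(a * ((√3 : ℝ) : ℂ))] ∨
        c = [a * ((√3 : ℝ) : ℂ), 0, -(a * ((√3 : ℝ) : ℂ)), 0]}) ∧
    (∀ k : ℕ, 4 ≤ k →
      {c : List ℂ | Quiddity.IsIrreducible (Quiddity.cyclic ((√(k : ℝ) : ℝ) : ℂ)) c} =
      {c : List ℂ | ∃ a : ℤ,
        c = [0, a * ((√(k : ℝ) : ℝ) : ℂ), 0, -(a * ((√(k : ℝ) : ℝ) : ℂ))] ∨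
        c = [a * ((√(k : ℝ) : ℝ) : ℂ), 0, -(a * ((√(k : ℝ) : ℝ) : ℂ)), 0]}) := by
  refine ⟨?_, ?_, ?_, ?_, fun k hk => ?_⟩
  · ext c
    rw [Real.sqrt_zero, Complex.ofReal_zero]
    exact Quiddity.isIrreducible_cyclic_zero_iff
  · ext c
    rw [Real.sqrt_one, Complex.ofReal_one]
    exact Quiddity.isIrreducible_cyclic_one_iff
  · ext c
    exact Quiddity.isIrreducible_cyclic_iff_of_sq_eq_two
      (by simpa using Quiddity.sqrt_sq_cast 2)
  · ext c
    exact Quiddity.isIrreducible_cyclic_iff_of_sq_eq_three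
      (by simpa using Quiddity.sqrt_sq_cast 3)
  · ext c
    exact Quiddity.isIrreducible_cyclic_iff_of_four_le (Quiddity.sqrt_sq_cast k) hk
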